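/- Let $\Sigma$ be a finite set and let $(\Sigma^*,\varepsilon,\cdot)$ be the free monoid on $\Sigma$, viewed as a structure in the signature $\{1,\cdot\}$ of monoids. Let $A\subseteq\Sigma^*$ be quantifier-free definable in $(\Sigma^*,\varepsilon,\cdot)$ with parameters from $\Sigma^*$, that is, $A=\{w\in\Sigma^* : \Sigma^*\models\varphi(w)\}$ for some quantifier-free formula $\varphi(x)$ in one free variable in the signature of monoids expanded by a constant symbol for each element of $\Sigma^*$. Then $A$ is a star-free language over $\Sigma$, i.e. it belongs to the smallest class of subsets of $\Sigma^*$ that contains the finite sets and is closed under Boolean combinations and element-wise concatenation. In particular, $A$ is a regular language over $\Sigma$, i.e. it belongs to the smallest class of subsets of $\Sigma^*$ that contains the finite sets and is closed under union, element-wise concatenation and Kleene star. -/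

import Mathlib

open FirstOrder
open scoped Computability

universe u

/-- The function symbols of the signature of monoids: a constant `1` and a binary product. -/
inductive MonoidFunc : ℕ → Type
  | one : MonoidFunc 0
  | mul : MonoidFunc 2

/-- The signature `{1, ·}` of monoids; it has no relation symbols besides equality. -/
def monoidLanguage : FirstOrder.Language where
  Functions := MonoidFunc
  Relations := fun _ => Empty

/-- Every monoid is a structure for the signature of monoids in the obvious way. -/
instance monoidStructure (M : Type*) [Monoid M] : monoidLanguage.Structure M where
  funMap := fun {n} f =>
    match n, f with
    | _, MonoidFunc.one => fun _ => 1
    | _, MonoidFunc.mul => fun x => x 0 * x 1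
  RelMap := fun r => Empty.elim r

/-- A set `s` of tuples from an `L`-structure `M` is quantifier-free definable with parameters
from `P ⊆ M` if it is the solution set of a quantifier-free formula in the signature `L` expanded
by a constant for every element of `P`. This is `Set.Definable` with the additional requirement
that the formula be quantifier-free. -/
def QFDefinable {M ι : Type*} (P : Set M) (L : FirstOrder.Language) [L.Structure M]
    (s : Set (ι → M)) : Prop :=
  ∃ φ : L[[P]].Formula ι, φ.IsQF ∧ s = {v | φ.Realize v}

/-- Quantifier-free definability, with parameters from `P`, of a subset of `M` itself, by a formula
in one free variable (compare `Set.Definable₁`). -/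
def QFDefinable₁ {M : Type*} (P : Set M) (L : FirstOrder.Language) [L.Structure M]
    (s : Set M) : Prop :=
  QFDefinable P L {v : Fin 1 → M | v 0 ∈ s}

/-- The star-free languages over `α`: the smallest class of languages that contains the finite
languages and is closed under Boolean combinations and concatenation. -/
inductive IsStarFree {α : Type u} : Language α → Prop
  | finite (A : Language α) (hA : Set.Finite {w : List α | w ∈ A}) : IsStarFree A
  | union {A B : Language α} (hA : IsStarFree A) (hB : IsStarFree B) : IsStarFree (A + B)
  | compl {A : Language α} (hA : IsStarFree A) : IsStarFree Aᶜ
  | concat {A B : Language α} (hA : IsStarFree A) (hB : IsStarFree B) : IsStarFree (A * B)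

/-- The regular languages over `α`: the smallest class of languages that contains the finite
languages and is closed under union, concatenation and Kleene star. -/
inductive IsRegularLanguage {α : Type u} : Language α → Prop
  | finite (A : Language α) (hA : Set.Finite {w : List α | w ∈ A}) : IsRegularLanguage A
  | union {A B : Language α} (hA : IsRegularLanguage A) (hB : IsRegularLanguage B) :
      IsRegularLanguage (A + B)
  | concat {A B : Language α} (hA : IsRegularLanguage A) (hB : IsRegularLanguage B) :
      IsRegularLanguage (A * B)
  | star {A : Language α} (hA : IsRegularLanguage A) : IsRegularLanguage A∗

/-! A quantifier-free formula is a Boolean combination of word equations p(x) = q(x) in one unknown,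
so a single equation suffices. Cancelling common leading symbols shows that its solutions are all
words, finitely many words, or words x that are prefixes of wx for one fixed w ≠ ε
(`List.substVar_eq_trichotomy`).

In the last case x = tⁿs, where t is the primitive root of w and s is one of the finitely many
prefixes of w. For each s the admissible n form a finite or cofinite set
(`List.IsPrimitive.finite_or_finite_compl`), and t* is star-free because t is primitive
(`List.IsPrimitive.isStarFree_powers`); hence so is each piece, and their finite union.

Star-free languages have finitely many left quotients, and these satisfy a linear system whose
solution by elimination uses only union, concatenation and star. -/

/-! ### Regular and star-free languages -/

section RegularLanguages

variable {α : Type*}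

theorem Language.mem_compl_iff' {A : Language α} {w : List α} : w ∈ Aᶜ ↔ w ∉ A := Iff.rfl

theorem Language.mem_finset_sum {ι : Type*} (s : Finset ι) (f : ι → Language α) (w : List α) :
    w ∈ ∑ i ∈ s, f i ↔ ∃ i ∈ s, w ∈ f i := by
  classical
  induction s using Finset.induction_on with
  | empty => simp [Language.notMem_zero]
  | insert a s ha ih => rw [Finset.sum_insert ha, Language.mem_add, ih]; simp

namespace IsRegularLanguage

theorem zero : IsRegularLanguage (0 : Language α) :=
  .finite _ (by simp [Language.notMem_zero])

/-- Gaussian elimination for systems of linear equations over languages. -/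
theorem of_linear_system : ∀ (n : ℕ) (X : Fin n → Language α) (A : Fin n → Fin n → Language α)
    (B : Fin n → Language α), (∀ i j, IsRegularLanguage (A i j)) → (∀ i j, [] ∉ A i j) →
    (∀ i, IsRegularLanguage (B i)) → (∀ i, X i = ∑ j, A i j * X j + B i) →
    ∀ i, IsRegularLanguage (X i) := by
  intro n
  induction n with
  | zero => intro X A B _ _ _ _ i; exact i.elim0
  | succ n ih =>
    intro X A B hA hε hB hX
    set l := Fin.last n
    -- Arden's rule solves the last equation for its own unknown, as `A l l` omits the empty word.
    have hl : X l = (A l l)∗ * (∑ j : Fin n, A l j.castSucc * X j.castSucc + B l) := by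
      rw [← Language.self_eq_mul_add_iff (hε l l)]
      conv_lhs => rw [hX l, Fin.sum_univ_castSucc]
      rw [add_comm (∑ i : Fin n, _) (A l (Fin.last n) * _), add_assoc]
    have key : ∀ i : Fin n, IsRegularLanguage (X i.castSucc) := by
      refine ih (fun i => X i.castSucc)
        (fun i j => A i.castSucc j.castSucc + A i.castSucc l * ((A l l)∗ * A l j.castSucc))
        (fun i => A i.castSucc l * ((A l l)∗ * B l) + B i.castSucc) ?_ ?_ ?_ ?_
      · exact fun i j => (hA _ _).union ((hA _ _).concat ((hA _ _).star.concat (hA _ _)))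
      · intro i j h
        rw [Language.mem_add, Language.mem_mul] at h
        rcases h with h | ⟨a, ha, b, _, hab⟩
        · exact hε _ _ h
        · rw [List.append_eq_nil_iff] at hab
          exact hε _ _ (hab.1 ▸ ha)
      · exact fun i => ((hA _ _).concat ((hA _ _).star.concat (hB _))).union (hB _)
      · intro i
        conv_lhs => rw [hX i.castSucc, Fin.sum_univ_castSucc]
        change _ + A i.castSucc l * X l + _ = _
        rw [hl]
        simp only [mul_add, add_mul, Finset.mul_sum, Finset.sum_add_distrib, mul_assoc, add_assoc]
    have hsum : ∀ s : Finset (Fin n),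
        IsRegularLanguage (∑ j ∈ s, A l j.castSucc * X j.castSucc) := by
      intro s
      induction s using Finset.induction_on with
      | empty => simpa using zero
      | insert a s ha ih' =>
        rw [Finset.sum_insert ha]
        exact ((hA _ _).concat (key a)).union ih'
    intro i
    induction i using Fin.lastCases with
    | last => exact hl ▸ (hA _ _).star.concat ((hsum _).union (hB _))
    | cast i => exact key i

/-- Each left quotient X is the union of a · (a⁻¹X) over the letters a, plus ε if ε ∈ X. By
Myhill–Nerode there are finitely many quotients, so this is a finite linear system with ε-free
coefficients. -/
theorem of_isRegular [Finite α] {L : Language α} (h : L.IsRegular) : IsRegularLanguage L := by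
  classical
  have hfin := h.finite_range_leftQuotient
  obtain ⟨n, ⟨e⟩⟩ := @Finite.exists_equiv_fin _ hfin.to_subtype
  let X : Fin n → Language α := fun i => (e.symm i).1
  have hXq : ∀ i a, ∃ j, X j = (X i).leftQuotient [a] := by
    intro i a
    obtain ⟨x, hx⟩ := (e.symm i).2
    refine ⟨e ⟨L.leftQuotient (x ++ [a]), x ++ [a], rfl⟩, ?_⟩
    simp only [X, Equiv.symm_apply_apply, ← hx, Language.leftQuotient_append]
  let A : Fin n → Fin n → Language α :=
    fun i j => {w : List α | ∃ a, w = [a] ∧ (X i).leftQuotient [a] = X j}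
  let B : Fin n → Language α := fun i => {w : List α | w = [] ∧ [] ∈ X i}
  have key := of_linear_system n X A B ?_ ?_ ?_ ?_ (e ⟨L, [], rfl⟩)
  · simpa [X] using key
  · intro i j
    refine .finite _ ((Set.finite_range fun a : α => [a]).subset ?_)
    rintro w ⟨a, rfl, _⟩
    exact ⟨a, rfl⟩
  · rintro i j ⟨a, h, _⟩
    exact List.cons_ne_nil _ _ h.symm
  · intro i
    refine .finite _ ((Set.finite_singleton ([] : List α)).subset ?_)
    rintro w ⟨rfl, _⟩
    rfl
  · intro i
    ext w
    rw [Language.mem_add, Language.mem_finset_sum]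
    constructor
    · intro hw
      cases w with
      | nil => exact Or.inr ⟨rfl, hw⟩
      | cons a u =>
        obtain ⟨j, hj⟩ := hXq i a
        refine Or.inl ⟨j, Finset.mem_univ _, Language.mem_mul.2
          ⟨[a], ⟨a, rfl, hj.symm⟩, u, ?_, rfl⟩⟩
        rw [hj]
        exact hw
    · rintro (⟨j, _, hj⟩ | ⟨rfl, h⟩)
      · obtain ⟨_, ⟨a, rfl, ha⟩, u, hu, rfl⟩ := Language.mem_mul.1 hj
        rw [← ha] at hu
        exact hu
      · exact h

end IsRegularLanguage

theorem Language.IsRegular.of_finite {A : Language α} (hA : Set.Finite {w : List α | w ∈ A}) :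
    A.IsRegular := by
  apply Language.IsRegular.of_finite_range_leftQuotient
  have hT : (⋃ w ∈ {w : List α | w ∈ A}, {y | y ∈ w.tails}).Finite :=
    hA.biUnion fun w _ => List.finite_toSet _
  refine hT.finite_subsets.subset ?_
  rintro _ ⟨x, rfl⟩ y hy
  simp only [Set.mem_iUnion]
  exact ⟨x ++ y, hy, (List.mem_tails _ _).2 (List.suffix_append x y)⟩

/-- x⁻¹(AB) is (x⁻¹A)B together with all s⁻¹B for x = rs, r ∈ A. It is thus determined by one
quotient of A and a set of quotients of B. -/
theorem Language.IsRegular.mul {A B : Language α} (hA : A.IsRegular) (hB : B.IsRegular) :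
    (A * B).IsRegular := by
  apply Language.IsRegular.of_finite_range_leftQuotient
  refine (Set.Finite.image2 (fun (P : Language α) (Q : Set (Language α)) => P * B + sSup Q)
    hA.finite_range_leftQuotient hB.finite_range_leftQuotient.finite_subsets).subset ?_
  rintro _ ⟨x, rfl⟩
  refine ⟨A.leftQuotient x, ⟨x, rfl⟩,
    {C | ∃ r ∈ A, ∃ s, r ++ s = x ∧ B.leftQuotient s = C}, ?_, ?_⟩
  · rintro _ ⟨r, _, s, _, rfl⟩
    exact ⟨s, rfl⟩
  · ext w
    have hsup : ∀ Q : Set (Language α), w ∈ sSup Q ↔ ∃ C ∈ Q, w ∈ C := by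
      intro Q
      rw [sSup_eq_iSup', Language.mem_iSup]
      simp
    simp only [Language.mem_add, hsup, Language.mem_leftQuotient, Language.mem_mul]
    constructor
    · rintro (⟨a, ha, b, hb, rfl⟩ | ⟨_, ⟨r, hr, s, rfl, rfl⟩, hw⟩)
      · exact ⟨x ++ a, ha, b, hb, by simp⟩
      · exact ⟨r, hr, s ++ w, hw, by simp⟩
    · rintro ⟨a, ha, b, hb, h⟩
      rcases List.append_eq_append_iff.1 h with ⟨c, rfl, rfl⟩ | ⟨c, rfl, rfl⟩
      · exact Or.inr ⟨_, ⟨a, ha, c, rfl, rfl⟩, hb⟩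
      · exact Or.inl ⟨c, ha, b, hb, rfl⟩

namespace IsStarFree

theorem isRegular {A : Language α} (h : IsStarFree A) : A.IsRegular := by
  induction h with
  | finite A hA => exact .of_finite hA
  | union _ _ hA hB => exact hA.add hB
  | compl _ hA => exact hA.compl
  | concat _ _ hA hB => exact hA.mul hB

theorem zero : IsStarFree (0 : Language α) :=
  .finite _ (by simp [Language.notMem_zero])

theorem top : IsStarFree (⊤ : Language α) := by
  have h : (⊤ : Language α) = (0 : Language α)ᶜ := compl_bot.symm
  exact h ▸ zero.compl

theorem inf {A B : Language α} (hA : IsStarFree A) (hB : IsStarFree B) : IsStarFree (A ⊓ B) := by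
  have h : A ⊓ B = (Aᶜ + Bᶜ)ᶜ := by
    change A ⊓ B = (Aᶜ ⊔ Bᶜ)ᶜ
    rw [compl_sup, compl_compl, compl_compl]
  exact h ▸ (hA.compl.union hB.compl).compl

theorem sum {ι : Type*} (s : Finset ι) (f : ι → Language α) (h : ∀ i ∈ s, IsStarFree (f i)) :
    IsStarFree (∑ i ∈ s, f i) := by
  classical
  induction s using Finset.induction_on with
  | empty => simpa using zero
  | insert a s ha ih =>
    rw [Finset.sum_insert ha]
    exact (h a (Finset.mem_insert_self _ _)).union
      (ih fun i hi => h i (Finset.mem_insert_of_mem hi))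

end IsStarFree

end RegularLanguages

/-! ### Powers, periods and primitive words -/

section Words

variable {α : Type*}

/-- The `n`-th power of a word in the free monoid. -/
def List.wpow (t : List α) (n : ℕ) : List α := (List.replicate n t).flatten

theorem List.wpow_zero (t : List α) : t.wpow 0 = [] := rfl

theorem List.wpow_succ (t : List α) (n : ℕ) : t.wpow (n + 1) = t ++ t.wpow n := by
  simp [wpow, List.replicate_succ]

theorem List.wpow_add (t : List α) (m n : ℕ) : t.wpow (m + n) = t.wpow m ++ t.wpow n := by
  rw [wpow, List.replicate_add, List.flatten_append]; rfl

theorem List.wpow_one (t : List α) : t.wpow 1 = t := by simp [wpow]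

theorem List.wpow_mul (t : List α) (m n : ℕ) : t.wpow (m * n) = (t.wpow m).wpow n := by
  induction n with
  | zero => rfl
  | succ n ih => rw [Nat.mul_succ, Nat.add_comm, wpow_add, wpow_succ, ih]

theorem List.wpow_succ' (t : List α) (n : ℕ) : t.wpow (n + 1) = t.wpow n ++ t := by
  rw [wpow_add, wpow_one]

theorem List.wpow_append_comm (t : List α) (m n : ℕ) :
    t.wpow m ++ t.wpow n = t.wpow n ++ t.wpow m := by
  rw [← wpow_add, Nat.add_comm, wpow_add]

theorem List.length_wpow (t : List α) (n : ℕ) : (t.wpow n).length = n * t.length := by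
  simp [wpow]

/-- A nonempty word is primitive if it equals none of its nontrivial conjugates. -/
def List.IsPrimitive (t : List α) : Prop :=
  t ≠ [] ∧ ∀ q r : List α, t = q ++ r → q ++ r = r ++ q → q = [] ∨ r = []

/-- Euclid's algorithm: the shorter word is a prefix of the longer, and stripping it leaves a
commuting pair. -/
theorem List.exists_wpow_of_append_comm (q r : List α) (h : q ++ r = r ++ q) :
    ∃ s i j, q = wpow s i ∧ r = wpow s j := by
  induction hn : q.length + r.length using Nat.strong_induction_on generalizing q r with
  | _ n ih =>
    wlog hqr : q.length ≤ r.length generalizing q r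
    · obtain ⟨s, i, j, hi, hj⟩ := this r q h.symm (by omega) (by omega)
      exact ⟨s, j, i, hj, hi⟩
    rcases eq_or_ne q [] with rfl | hq
    · exact ⟨r, 0, 1, rfl, (wpow_one r).symm⟩
    obtain ⟨r', rfl⟩ : q <+: r := List.prefix_of_prefix_length_le (List.prefix_append q r)
      (h ▸ List.prefix_append r q) hqr
    have hq' := List.length_pos_iff.2 hq
    have h' : q ++ r' = r' ++ q := by
      rw [List.append_assoc] at h
      exact List.append_cancel_left h
    obtain ⟨s, i, j, hi, hj⟩ := ih _ (by rw [← hn, List.length_append]; omega) q r' h' rfl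
    exact ⟨s, i, i + j, hi, by rw [wpow_add, ← hi, ← hj]⟩

theorem List.exists_isPrimitive_wpow (w : List α) (hw : w ≠ []) :
    ∃ t k, IsPrimitive t ∧ w = wpow t k := by
  induction hn : w.length using Nat.strong_induction_on generalizing w with
  | _ n ih =>
    by_cases hp : w.IsPrimitive
    · exact ⟨w, 1, hp, (wpow_one w).symm⟩
    · have : ∃ q r : List α, w = q ++ r ∧ q ++ r = r ++ q ∧ q ≠ [] ∧ r ≠ [] := by
        by_contra! hcon
        refine hp ⟨hw, fun q r h1 h2 => ?_⟩
        by_cases hq : q = []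
        · exact Or.inl hq
        · exact Or.inr (hcon q r h1 h2 hq)
      obtain ⟨q, r, rfl, hcomm, hq, hr⟩ := this
      obtain ⟨s, i, j, rfl, rfl⟩ := exists_wpow_of_append_comm q r hcomm
      have hs : s ≠ [] := by
        rintro rfl
        simp [wpow] at hq
      have hi : i ≠ 0 := by
        rintro rfl
        exact hq rfl
      have hj : j ≠ 0 := by
        rintro rfl
        exact hr rfl
      have hlt : s.length < n := by
        rw [← hn, ← wpow_add, length_wpow]
        have := List.length_pos_iff.2 hs
        nlinarith [Nat.pos_of_ne_zero hi, Nat.pos_of_ne_zero hj]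
      obtain ⟨t, k, ht, hk⟩ := ih _ hlt s hs rfl
      exact ⟨t, k * (i + j), ht, by rw [← wpow_add, wpow_mul, ← hk]⟩

/-- A primitive word occurs in its powers only at the obvious positions. -/
theorem List.IsPrimitive.eq_wpow_of_prefix {t : List α} (ht : t.IsPrimitive) (u : List α) (N : ℕ)
    (h : u ++ t <+: t.wpow N) : ∃ k, u = t.wpow k := by
  have ht0 := List.length_pos_iff.2 ht.1
  induction N generalizing u with
  | zero =>
    have := h.length_le
    rw [wpow_zero, List.length_append, List.length_nil] at this
    omega
  | succ N ih =>
    rw [wpow_succ] at h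
    rcases le_total t.length u.length with hle | hle
    · obtain ⟨v, rfl⟩ : t <+: u := List.prefix_of_prefix_length_le (List.prefix_append _ _)
        ((List.prefix_append _ _).trans h) hle
      rw [List.append_assoc, List.prefix_append_right_inj] at h
      obtain ⟨k, rfl⟩ := ih v h
      exact ⟨k + 1, (wpow_succ t k).symm⟩
    · obtain ⟨r, hr⟩ : u <+: t := List.prefix_of_prefix_length_le
        ((List.prefix_append _ _).trans h) (List.prefix_append _ _) hle
      rcases N with _ | N
      · have := h.length_le
        rw [wpow_zero, List.append_nil, List.length_append] at this
        exact ⟨0, List.length_eq_zero_iff.1 (by omega)⟩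
      · have h1 : t <+: r ++ (t ++ t.wpow N) := by
          rw [← List.prefix_append_right_inj u, ← List.append_assoc u r, hr, ← wpow_succ]
          exact h
        -- `t = u ++ r` and `r ++ u` are prefixes of the same word and have equal length.
        have h2 : u ++ r = r ++ u := by
          have h3 : r ++ u <+: r ++ (t ++ t.wpow N) := by
            rw [List.prefix_append_right_inj]
            exact (hr ▸ List.prefix_append u r).trans (List.prefix_append _ _)
          rw [hr]
          refine (List.prefix_of_prefix_length_le h1 h3 ?_).eq_of_length ?_ <;>
          · rw [← hr, List.length_append, List.length_append]; omega
        rcases ht.2 u r hr.symm h2 with rfl | rfl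
        · exact ⟨0, rfl⟩
        · exact ⟨1, by rw [wpow_one, ← hr, List.append_nil]⟩

/-- Every word with period `w.length` that starts like `w` is a prefix of a power of `w`. -/
theorem List.exists_wpow_append_of_prefix (w : List α) (hw : w ≠ []) (x : List α)
    (h : x <+: w ++ x) : ∃ n p, p <+: w ∧ x = w.wpow n ++ p := by
  induction hn : x.length using Nat.strong_induction_on generalizing x with
  | _ n ih =>
    rcases le_total x.length w.length with hle | hle
    · exact ⟨0, x, List.prefix_of_prefix_length_le h (List.prefix_append _ _) hle, rfl⟩
    · obtain ⟨v, rfl⟩ := List.prefix_of_prefix_length_le (List.prefix_append _ _) h hle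
      rw [List.prefix_append_right_inj] at h
      have := List.length_pos_iff.2 hw
      obtain ⟨m, p, hp, hv⟩ := ih v.length (by rw [← hn, List.length_append]; omega) v h rfl
      exact ⟨m + 1, p, hp, by rw [wpow_succ, List.append_assoc, ← hv]⟩

/-- The language of all powers of a word. -/
def List.powers (t : List α) : Language α := Set.range t.wpow

theorem List.mem_powers {t w : List α} : w ∈ t.powers ↔ ∃ n, t.wpow n = w := Iff.rfl

/-- The language of powers of a primitive word is star-free. -/
theorem List.IsPrimitive.isStarFree_powers [Finite α] {t : List α} (ht : t.IsPrimitive) :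
    IsStarFree t.powers := by
  have ht0 := List.length_pos_iff.2 ht.1
  let E : Language α := {w : List α | w = []}
  let T : Language α := {w : List α | w = t}
  let F : Language α := {w : List α | ∃ y, y.length ≤ t.length ∧ ¬ y <+: t ∧ w = t ++ y}
  have hE : IsStarFree E := .finite _ (Set.finite_singleton ([] : List α))
  have hT : IsStarFree T := .finite _ (Set.finite_singleton t)
  have hF : IsStarFree F := by
    refine .finite _ ((List.finite_length_le α (2 * t.length)).subset ?_)
    rintro w ⟨y, hy, _, rfl⟩
    simp only [Set.mem_ofPred_eq, List.length_append]
    omega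
  -- A nonempty power of t is a word that begins and ends with t and in which no occurrence of t is
  -- followed by a block of length at most |t| that is not a prefix of t.
  have key : t.powers = E + (T * ⊤) ⊓ (⊤ * T) ⊓ (⊤ * F * ⊤)ᶜ := by
    ext x
    rw [List.mem_powers, Language.mem_add, Language.mem_inf, Language.mem_inf, Language.mem_compl_iff']
    constructor
    · rintro ⟨n, rfl⟩
      rcases n with _ | n
      · exact Or.inl rfl
      refine Or.inr ⟨⟨?_, ?_⟩, ?_⟩
      · exact Language.mem_mul.2 ⟨t, rfl, t.wpow n, trivial, (wpow_succ t n).symm⟩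
      · exact Language.mem_mul.2 ⟨t.wpow n, trivial, t, rfl, (wpow_succ' t n).symm⟩
      · intro h
        obtain ⟨_, h, v, -, hx⟩ := Language.mem_mul.1 h
        obtain ⟨u, -, _, ⟨y, hy, hyt, rfl⟩, rfl⟩ := Language.mem_mul.1 h
        obtain ⟨k, rfl⟩ := ht.eq_wpow_of_prefix u (n + 1) ⟨y ++ v, by rw [← hx]; simp⟩
        apply hyt
        have hlen := congrArg List.length hx
        simp only [List.length_append, length_wpow] at hlen
        have hkn : k ≤ n := by
          by_contra hcon
          have : (n + 1) * t.length ≤ k * t.length := Nat.mul_le_mul_right _ (by omega)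
          omega
        obtain ⟨m, rfl⟩ := Nat.exists_eq_add_of_le hkn
        rw [Nat.add_assoc, wpow_add, List.append_assoc, List.append_cancel_left_eq,
          Nat.add_comm, Nat.add_comm, wpow_succ, List.append_assoc,
          List.append_cancel_left_eq] at hx
        rcases m with _ | m
        · rw [wpow_zero, List.append_eq_nil_iff] at hx
          rw [hx.1]
          exact List.nil_prefix
        · rw [wpow_succ] at hx
          exact List.prefix_of_prefix_length_le (List.prefix_append y v)
            (hx ▸ List.prefix_append _ _) hy
    · rintro (hx | ⟨⟨h1, h2⟩, h3⟩)
      · exact ⟨0, hx.symm⟩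
      · obtain ⟨z, rfl⟩ : ∃ z, t ++ z = x := by
          obtain ⟨a, ha, z, -, hz⟩ := Language.mem_mul.1 h1
          exact ⟨z, (show a = t from ha) ▸ hz⟩
        obtain ⟨u, hu⟩ : ∃ u, u ++ t = t ++ z := by
          obtain ⟨u, -, a, ha, hu⟩ := Language.mem_mul.1 h2
          exact ⟨u, (show a = t from ha) ▸ hu⟩
        have h3' : ∀ a y b, y.length ≤ t.length → a ++ (t ++ y) ++ b = t ++ z → y <+: t := by
          intro a y b hy hab
          by_contra hyt
          exact h3 (Language.mem_mul.2 ⟨_, Language.mem_mul.2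
            ⟨a, trivial, _, ⟨y, hy, hyt, rfl⟩, rfl⟩, b, trivial, hab⟩)
        -- After each t, the next |t| letters again spell t, until a short prefix of t remains. The
        -- final t must then be aligned, by primitivity, so that remainder closes up.
        have hstep : ∀ (n : ℕ) (b a : List α), b.length = n → a ++ t ++ b = t ++ z →
            ∃ n, b <+: t.wpow n := by
          intro n
          induction n using Nat.strong_induction_on with
          | _ n ih =>
            intro b a hn hab
            rcases le_total b.length t.length with hle | hle
            · exact ⟨1, by rw [wpow_one]; exact h3' a b [] hle (by rw [← hab]; simp)⟩
            · have h4 : b.take t.length <+: t :=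
                h3' a (b.take t.length) (b.drop t.length) (by simp)
                  (by rw [← hab]; simp)
              have h5 := h4.eq_of_length (by simp [hle])
              have h6 := List.take_append_drop t.length b
              rw [h5] at h6
              obtain ⟨m, hm⟩ := ih (b.drop t.length).length
                (by rw [List.length_drop]; omega) _ (a ++ t) rfl (by
                  rw [← hab, List.append_assoc (a ++ t), h6])
              exact ⟨m + 1, by rw [← h6, wpow_succ, List.prefix_append_right_inj]; exact hm⟩
        obtain ⟨n, hn⟩ := hstep _ z [] rfl rfl
        obtain ⟨k, rfl⟩ := ht.eq_wpow_of_prefix u (n + 1) (by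
          rw [hu, wpow_succ, List.prefix_append_right_inj]; exact hn)
        exact ⟨k + 1, by rw [← hu, wpow_succ']⟩
  rw [key]
  exact hE.union (((hT.concat .top).inf (IsStarFree.top.concat hT)).inf
    ((IsStarFree.top.concat hF).concat .top).compl)

end Words

/-! ### Word equations in one unknown -/

section WordEquations

variable {α : Type*}

/-- Substitute the word `x` for the variable `none` in a word with letters and a variable. -/
def List.substVar (p : List (Option α)) (x : List α) : List α :=
  p.flatMap fun o => o.elim x fun a => [a]

theorem List.substVar_none (p : List (Option α)) (x : List α) :
    substVar (none :: p) x = x ++ substVar p x := rfl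

theorem List.substVar_some (a : α) (p : List (Option α)) (x : List α) :
    substVar (some a :: p) x = a :: substVar p x := rfl

theorem List.substVar_append (p q : List (Option α)) (x : List α) :
    substVar (p ++ q) x = substVar p x ++ substVar q x := by
  simp [substVar]

theorem List.substVar_map_some (w x : List α) : substVar (w.map some) x = w := by
  induction w with
  | nil => rfl
  | cons a w ih => rw [List.map_cons, substVar_some, ih]

theorem List.substVar_flatMap (p : List (Option α)) (r : List (Option α)) (x : List α) :
    substVar (p.flatMap fun o => o.elim r fun a => [some a]) x = substVar p (substVar r x) := by
  induction p with
  | nil => rfl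
  | cons o p ih =>
    cases o <;> simp [substVar_append, substVar_none, substVar_some, ih]

/-- A word with a variable is constant, or starts with a constant word followed by the variable. -/
theorem List.eq_map_some_or_exists_none (q : List (Option α)) :
    (∃ w : List α, q = w.map some) ∨
      ∃ (w : List α) (q' : List (Option α)), q = w.map some ++ none :: q' := by
  induction q with
  | nil => exact Or.inl ⟨[], rfl⟩
  | cons o q ih =>
    cases o with
    | none => exact Or.inr ⟨[], q, rfl⟩
    | some a =>
      rcases ih with ⟨w, rfl⟩ | ⟨w, q', rfl⟩
      · exact Or.inl ⟨a :: w, rfl⟩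
      · exact Or.inr ⟨a :: w, q', rfl⟩

/-- The right side starts with a nonempty constant word, followed by x or by nothing; comparing it
with the leading x on the left gives the period. -/
theorem List.prefix_of_substVar_eq (p q : List (Option α)) (a : α) : ∃ w : List α, w ≠ [] ∧
    ∀ x, substVar (none :: p) x = substVar (some a :: q) x → x <+: w ++ x := by
  rcases eq_map_some_or_exists_none q with ⟨w, rfl⟩ | ⟨w, q', rfl⟩
  · refine ⟨a :: w, List.cons_ne_nil _ _, fun x hx => ?_⟩
    rw [substVar_none, substVar_some, substVar_map_some] at hx
    exact (hx ▸ List.prefix_append _ _ : x <+: a :: w).trans (List.prefix_append _ _)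
  · refine ⟨a :: w, List.cons_ne_nil _ _, fun x hx => ?_⟩
    rw [substVar_none, substVar_some, substVar_append, substVar_map_some, substVar_none] at hx
    refine List.prefix_of_prefix_length_le (l₃ := a :: (w ++ (x ++ substVar q' x)))
      (hx ▸ List.prefix_append _ _) ⟨substVar q' x, by simp⟩ (by simp; omega)

/-- The solutions of a word equation in one variable are all words, finitely many words, or share a
period with all their prefixes. -/
theorem List.substVar_eq_trichotomy (p q : List (Option α)) :
    (∀ x, substVar p x = substVar q x) ∨ {x | substVar p x = substVar q x}.Finite ∨
      ∃ w : List α, w ≠ [] ∧ ∀ x, substVar p x = substVar q x → x <+: w ++ x := by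
  induction p generalizing q with
  | nil =>
    cases q with
    | nil => exact Or.inl fun _ => rfl
    | cons o q =>
      refine Or.inr (Or.inl ((Set.finite_singleton ([] : List α)).subset fun x hx => ?_))
      cases o with
      | none => exact (List.append_eq_nil_iff.1 (Eq.symm hx)).1
      | some a => exact absurd (Eq.symm hx) (List.cons_ne_nil _ _)
  | cons o p ih =>
    cases q with
    | nil =>
      refine Or.inr (Or.inl ((Set.finite_singleton ([] : List α)).subset fun x hx => ?_))
      cases o with
      | none => exact (List.append_eq_nil_iff.1 hx).1
      | some a => exact absurd hx (List.cons_ne_nil _ _)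
    | cons o' q =>
      rcases o with _ | a <;> rcases o' with _ | b
      · simpa only [substVar_none, List.append_cancel_left_eq] using ih q
      · exact Or.inr (Or.inr (prefix_of_substVar_eq p q b))
      · obtain ⟨w, hw, h⟩ := prefix_of_substVar_eq q p a
        exact Or.inr (Or.inr ⟨w, hw, fun x hx => h x hx.symm⟩)
      · by_cases hab : a = b
        · subst hab
          simpa only [substVar_some, List.cons.injEq, true_and] using ih q
        · refine Or.inr (Or.inl (Set.finite_empty.subset fun x hx => hab ?_))
          exact (List.cons.inj hx).1

/-- A finiteness dichotomy for an equation starting with the variable on the left only. -/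
theorem List.IsPrimitive.finite_or_finite_compl_of_none_some {t : List α} (ht : t.IsPrimitive)
    (p q : List (Option α)) (a : α)
    (ih : ∀ p' q' : List (Option α), p'.length + q'.length < p.length + 1 + (q.length + 1) →
      {n | substVar p' (t.wpow n) = substVar q' (t.wpow n)}.Finite ∨
      {n | substVar p' (t.wpow n) = substVar q' (t.wpow n)}ᶜ.Finite) :
    {n | substVar (none :: p) (t.wpow n) = substVar (some a :: q) (t.wpow n)}.Finite ∨
    {n | substVar (none :: p) (t.wpow n) = substVar (some a :: q) (t.wpow n)}ᶜ.Finite := by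
  have ht0 := List.length_pos_iff.2 ht.1
  rcases eq_map_some_or_exists_none q with ⟨w, rfl⟩ | ⟨w, q', rfl⟩
  · refine Or.inl ((Set.finite_le_nat (a :: w).length).subset fun n hn => ?_)
    have := congrArg List.length (show _ = _ from hn)
    rw [substVar_none, substVar_some, substVar_map_some, List.length_append, length_wpow] at this
    change n ≤ _
    nlinarith
  · by_cases hw : ∃ k, a :: w = t.wpow k
    -- A power of t commutes with tⁿ, so the leading unknown cancels on both sides and a shorter
    -- equation remains.
    · obtain ⟨k, hk⟩ := hw
      have h : ∀ n, substVar (none :: p) (t.wpow n) =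
          substVar (some a :: (w.map some ++ none :: q')) (t.wpow n) ↔
          substVar p (t.wpow n) = substVar ((a :: w).map some ++ q') (t.wpow n) := by
        intro n
        rw [substVar_none, substVar_some, substVar_append, substVar_map_some, substVar_none,
          substVar_append, substVar_map_some, ← List.cons_append, hk, ← List.append_assoc,
          wpow_append_comm, List.append_assoc, List.append_cancel_left_eq]
      simp only [h]
      exact ih _ _ (by simp; omega)
    -- For larger n, a full t following `a :: w` still fits inside tⁿ, so primitivity would make `a
    -- :: w` a power of t.
    · refine Or.inl ((Set.finite_le_nat ((a :: w).length + 1)).subset fun n hn => ?_)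
      by_contra hcon
      apply hw
      have hcon' : (a :: w).length + 1 < n := not_le.1 hcon
      replace hn : substVar _ _ = substVar _ _ := hn
      rw [substVar_none, substVar_some, substVar_append, substVar_map_some, substVar_none] at hn
      obtain ⟨m, rfl⟩ : ∃ m, n = m + 1 := ⟨n - 1, by omega⟩
      refine ht.eq_wpow_of_prefix (a :: w) (m + 1) ?_
      refine List.prefix_of_prefix_length_le
        (l₃ := t.wpow (m + 1) ++ substVar p (t.wpow (m + 1))) ?_ (List.prefix_append _ _) ?_
      · rw [hn]
        exact ⟨t.wpow m ++ substVar q' (t.wpow (m + 1)), by simp [wpow_succ]⟩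
      · rw [List.length_append, length_wpow]
        nlinarith

theorem List.IsPrimitive.finite_or_finite_compl {t : List α} (ht : t.IsPrimitive)
    (p q : List (Option α)) :
    {n | substVar p (t.wpow n) = substVar q (t.wpow n)}.Finite ∨
    {n | substVar p (t.wpow n) = substVar q (t.wpow n)}ᶜ.Finite := by
  induction hN : p.length + q.length using Nat.strong_induction_on generalizing p q with
  | _ N ih =>
    have hnil : ∀ n, t.wpow n = [] → n ∈ ({0} : Set ℕ) := by
      intro n hn
      have := congrArg List.length hn
      rw [length_wpow] at this
      exact (Nat.mul_eq_zero.1 this).resolve_right fun h => ht.1 (List.length_eq_zero_iff.1 h)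
    rcases p with _ | ⟨o, p⟩ <;> rcases q with _ | ⟨o', q⟩
    · exact Or.inr (by simp)
    · refine Or.inl ((Set.finite_singleton 0).subset fun n hn => hnil n ?_)
      cases o' with
      | none => exact (List.append_eq_nil_iff.1 (Eq.symm hn)).1
      | some a => exact absurd (Eq.symm hn) (List.cons_ne_nil _ _)
    · refine Or.inl ((Set.finite_singleton 0).subset fun n hn => hnil n ?_)
      cases o with
      | none => exact (List.append_eq_nil_iff.1 hn).1
      | some a => exact absurd hn (List.cons_ne_nil _ _)
    · rw [List.length_cons, List.length_cons] at hN
      rcases o with _ | a <;> rcases o' with _ | b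
      · simp only [substVar_none, List.append_cancel_left_eq]
        exact ih _ (by omega) p q rfl
      · exact ht.finite_or_finite_compl_of_none_some p q b
          fun p' q' h => ih _ (by omega) p' q' rfl
      · have := ht.finite_or_finite_compl_of_none_some q p a
          fun p' q' h => ih _ (by omega) p' q' rfl
        simpa only [eq_comm] using this
      · by_cases hab : a = b
        · subst hab
          simp only [substVar_some, List.cons.injEq, true_and]
          exact ih _ (by omega) p q rfl
        · exact Or.inl (Set.finite_empty.subset fun n hn => hab (List.cons.inj hn).1)

/-- The language of the solutions of a word equation in one variable. -/
def solutionLanguage (p q : List (Option α)) : Language α := {x | p.substVar x = q.substVar x}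

theorem mem_solutionLanguage {p q : List (Option α)} {x : List α} :
    x ∈ solutionLanguage p q ↔ p.substVar x = q.substVar x := Iff.rfl

/-- In the cofinite case this is t*s minus a finite language; n is recovered from the length of tⁿs.
-/
theorem List.IsPrimitive.isStarFree_image [Finite α] {t : List α} (ht : t.IsPrimitive)
    (s : List α) (S : Set ℕ) (hS : S.Finite ∨ Sᶜ.Finite) (L : Language α)
    (hL : ∀ x, x ∈ L ↔ ∃ n ∈ S, t.wpow n ++ s = x) : IsStarFree L := by
  have hfin : ∀ (S : Set ℕ) (L : Language α), S.Finite →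
      (∀ x, x ∈ L ↔ ∃ n ∈ S, t.wpow n ++ s = x) → IsStarFree L := by
    intro S L hS hL
    refine .finite _ ((hS.image fun n => t.wpow n ++ s).subset fun x hx => ?_)
    exact (hL x).1 hx
  rcases hS with hS | hS
  · exact hfin S L hS hL
  · let C : Language α := {x | ∃ n ∈ Sᶜ, t.wpow n ++ s = x}
    let P : Language α := {x | x = s}
    have hC : IsStarFree C := hfin _ C hS fun _ => Iff.rfl
    have hP : IsStarFree P := .finite _ (Set.finite_singleton s)
    have hLe : L = t.powers * P ⊓ Cᶜ := by
      ext x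
      rw [Language.mem_inf, Language.mem_mul, Language.mem_compl_iff', hL]
      constructor
      · rintro ⟨n, hn, rfl⟩
        refine ⟨⟨_, ⟨n, rfl⟩, s, rfl, rfl⟩, ?_⟩
        rintro ⟨m, hm, h⟩
        have := congrArg List.length h
        rw [List.length_append, List.length_append, length_wpow, length_wpow] at this
        have := Nat.eq_of_mul_eq_mul_right (List.length_pos_iff.2 ht.1) (Nat.add_right_cancel this)
        exact hm (this ▸ hn)
      · rintro ⟨⟨_, ⟨n, rfl⟩, b, hb, rfl⟩, h⟩
        replace hb : b = s := hb
        subst b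
        refine ⟨n, ?_, rfl⟩
        by_contra hn
        exact h ⟨n, hn, rfl⟩
    rw [hLe]
    exact (ht.isStarFree_powers.concat hP).inf hC.compl

theorem isStarFree_solutionLanguage [Finite α] (p q : List (Option α)) :
    IsStarFree (solutionLanguage p q) := by
  classical
  rcases List.substVar_eq_trichotomy p q with h | h | ⟨w, hw, h⟩
  · have : solutionLanguage p q = ⊤ := by
      ext x
      exact ⟨fun _ => trivial, fun _ => h x⟩
    exact this ▸ .top
  · exact .finite _ h
  · obtain ⟨t, k, ht, rfl⟩ := w.exists_isPrimitive_wpow hw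
    let S : List α → Set ℕ := fun s =>
      {n | p.substVar (t.wpow n ++ s) = q.substVar (t.wpow n ++ s)}
    let f : List α → Language α := fun s => {x | ∃ n ∈ S s, t.wpow n ++ s = x}
    -- Exponents that are not multiples of k do no harm, since `S s` admits only solutions.
    have hsum : solutionLanguage p q = ∑ s ∈ (t.wpow k).inits.toFinset, f s := by
      ext x
      rw [Language.mem_finset_sum, mem_solutionLanguage]
      constructor
      · intro hx
        obtain ⟨n, s, hs, rfl⟩ := List.exists_wpow_append_of_prefix _ hw x (h x hx)
        rw [← List.wpow_mul] at hx ⊢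
        exact ⟨s, by simpa using hs, k * n, hx, rfl⟩
      · rintro ⟨s, -, n, hn, rfl⟩
        exact hn
    rw [hsum]
    refine IsStarFree.sum _ _ fun s _ => ht.isStarFree_image s (S s) ?_ _ fun _ => Iff.rfl
    -- Replacing the unknown by the unknown followed by s gives an equation for tⁿ alone.
    have := ht.finite_or_finite_compl
      (p.flatMap fun o => o.elim (none :: s.map some) fun a => [some a])
      (q.flatMap fun o => o.elim (none :: s.map some) fun a => [some a])
    simpa only [List.substVar_flatMap, List.substVar_none, List.substVar_map_some] using this

end WordEquations

/-! ### From quantifier-free formulas to word equations -/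

section Definability

variable {α : Type*}

theorem exists_substVar_eq_realize
    (t : (monoidLanguage[[(Set.univ : Set (FreeMonoid α))]]).Term (Fin 1 ⊕ Fin 0)) :
    ∃ p : List (Option α), ∀ w : FreeMonoid α,
      FreeMonoid.toList (t.realize (Sum.elim (fun _ => w) default)) =
        p.substVar (FreeMonoid.toList w) := by
  induction t with
  | var i =>
    rcases i with i | i
    · exact ⟨[none], fun w => (List.append_nil _).symm⟩
    · exact i.elim0
  | @func l f ts ih =>
    rcases f with f | c
    · cases f with
      | one => exact ⟨[], fun w => rfl⟩
      | mul =>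
        obtain ⟨p, hp⟩ := ih 0
        obtain ⟨q, hq⟩ := ih 1
        refine ⟨p ++ q, fun w => ?_⟩
        rw [List.substVar_append, ← hp, ← hq]
        rfl
    · cases l with
      | zero =>
        refine ⟨(FreeMonoid.toList (show (Set.univ : Set (FreeMonoid α)) from c).1).map some,
          fun w => ?_⟩
        rw [List.substVar_map_some]
        rfl
      | succ l => exact PEmpty.elim c

theorem isStarFree_of_isQF [Finite α]
    {φ : (monoidLanguage[[(Set.univ : Set (FreeMonoid α))]]).BoundedFormula (Fin 1) 0}
    (h : φ.IsQF) (A : Language α)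
    (hA : ∀ w : FreeMonoid α, FreeMonoid.toList w ∈ A ↔ φ.Realize (fun _ => w) default) :
    IsStarFree A := by
  induction h generalizing A with
  | falsum =>
    have : A = 0 := by
      ext w
      exact (hA (FreeMonoid.ofList w)).trans (iff_of_false id (Language.notMem_zero w))
    exact this ▸ .zero
  | of_isAtomic h =>
    cases h with
    | equal t₁ t₂ =>
      obtain ⟨p, hp⟩ := exists_substVar_eq_realize t₁
      obtain ⟨q, hq⟩ := exists_substVar_eq_realize t₂
      have : A = solutionLanguage p q := by
        ext w
        have hw := hA (FreeMonoid.ofList w)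
        rw [FirstOrder.Language.BoundedFormula.realize_bdEqual,
          ← FreeMonoid.toList.injective.eq_iff, hp, hq] at hw
        exact hw
      exact this ▸ isStarFree_solutionLanguage p q
    | rel R ts =>
      rcases R with R | R
      · exact Empty.elim R
      · exact Empty.elim R
  | @imp φ₁ φ₂ h₁ h₂ ih₁ ih₂ =>
    let L₁ : Language α := {w | φ₁.Realize (fun _ => FreeMonoid.ofList w) default}
    let L₂ : Language α := {w | φ₂.Realize (fun _ => FreeMonoid.ofList w) default}
    have : A = L₁ᶜ + L₂ := by
      ext w
      rw [Language.mem_add, Language.mem_compl_iff']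
      refine (hA (FreeMonoid.ofList w)).trans ?_
      rw [FirstOrder.Language.BoundedFormula.realize_imp]
      exact imp_iff_not_or
    exact this ▸ (ih₁ L₁ fun _ => Iff.rfl).compl.union (ih₂ L₂ fun _ => Iff.rfl)

end Definability

theorem mainTheorem3 {α : Type*} [Finite α] (A : Language α)
    (hA : QFDefinable₁ (Set.univ : Set (FreeMonoid α)) monoidLanguage
      {w : FreeMonoid α | FreeMonoid.toList w ∈ A}) :
    IsStarFree A ∧ IsRegularLanguage A := by
  obtain ⟨φ, hφ, h⟩ := hA
  have hs : IsStarFree A := isStarFree_of_isQF hφ A fun w => by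
    have hw := Set.ext_iff.1 h fun _ => w
    rw [Set.mem_ofPred_eq, Set.mem_ofPred_eq, Set.mem_ofPred_eq,
      FirstOrder.Language.Formula.Realize] at hw
    convert hw
  exact ⟨hs, .of_isRegular hs.isRegular⟩
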